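/- Let $n\ge 2$ and let $\Sigma_n=\{a_1<a_2<\cdots<a_n\}$ be an alphabet of $n$ positive integers that all leave the same remainder modulo $n$: $a_i=q_i\,n+r$ with integers $q_i\ge 0$ and $0\le r\le n-1$. Fix a cyclic order of $\Sigma_n$, that is, an arrangement $b_1b_2\cdots b_n$ of its letters with indices read modulo $n$. A generalized Kolakoski word over $\Sigma_n$ with this cyclic order is an infinite word $w=w_1w_2w_3\cdots$ over $\Sigma_n$ that equals its own sequence of run lengths and whose successive runs consist of letters following the cyclic order; that is, for some $s$, $w=u_1^{w_1}u_2^{w_2}u_3^{w_3}\cdots$ with $u_j=b_{s+j}$ for all $j\ge 1$. If $r=0$, or if $r>0$ and $n$ is even, then every generalized Kolakoski word over $\Sigma_n$ with the given cyclic order is uniformly recurrent: each of its finite factors occurs in it infinitely often with bounded gaps. -/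

import Mathlib

/-- `IsRunFactorization w α e` says that the infinite word `w` (letters indexed from `0`) is
`α 0 ^ e 0 · α 1 ^ e 1 · α 2 ^ e 2 ⋯` with nonempty blocks and distinct consecutive block letters,
i.e. that the blocks are the runs of `w`, that `α` is the base sequence of `w` and that
`e = Δ(w)` is its sequence of run lengths. The `j`-th run starts at position `e 0 + ⋯ + e (j-1)`. -/
def IsRunFactorization (w α e : ℕ → ℕ) : Prop :=
  (∀ j, 0 < e j) ∧ (∀ j, α j ≠ α (j + 1)) ∧
    ∀ j k, k < e j → w ((∑ l ∈ Finset.range j, e l) + k) = α j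

/-- `b` is an arrangement `b_1 b_2 ⋯ b_n`, with indices read modulo `n`, of the alphabet
`{a_1, …, a_n}`, each letter being listed once. -/
def IsCyclicOrder {n : ℕ} (a : Fin n → ℕ) (b : ZMod n → ℕ) : Prop :=
  Function.Injective b ∧ Set.range b = Set.range a

/-- The sequence `u` runs through the letters in the cyclic order `b`, from some starting letter. -/
def IsCompatible {n : ℕ} (b : ZMod n → ℕ) (u : ℕ → ℕ) : Prop :=
  ∃ s : ZMod n, ∀ j : ℕ, u j = b (s + (j : ZMod n))

/-- `w` is a generalized Kolakoski word over the alphabet `{a_1, …, a_n}` with the cyclic order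
`b`: an infinite word over the alphabet with `Δ(w) = w` whose base sequence is compatible
with `b`. -/
def IsGeneralizedKolakoski {n : ℕ} (a : Fin n → ℕ) (b : ZMod n → ℕ) (w : ℕ → ℕ) : Prop :=
  (∀ i, w i ∈ Set.range a) ∧ ∃ u : ℕ → ℕ, IsRunFactorization w u w ∧ IsCompatible b u

/-- The finite word `v` occurs in the infinite word `w` at position `p`. -/
def OccursAt (v : List ℕ) (w : ℕ → ℕ) (p : ℕ) : Prop :=
  (List.range v.length).map (fun j => w (p + j)) = v

/-- Every finite factor of `w` occurs infinitely often with bounded gaps. -/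
def UniformlyRecurrent (w : ℕ → ℕ) : Prop :=
  ∀ v : List ℕ, (∃ p, OccursAt v w p) →
    ∃ G : ℕ, ∀ N : ℕ, ∃ p, N ≤ p ∧ p ≤ N + G ∧ OccursAt v w p

/-!
Let `S j = w 0 + ⋯ + w (j - 1)`, the position at which the `j`-th run of `w` starts; as `Δ(w) = w`,
this is read off `w` itself. All letters are congruent modulo `n`, so any `n` consecutive letters
have a sum divisible by `n`, and `S` maps multiples of `n` to multiples of `n`
(`dvd_runStart`).

Suppose that `n ∣ p` and that `w` from position `p` on agrees with `w` from position `0` on for `m`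
letters. Then the runs number `p, p + 1, …` of `w` have the same letters as the runs `0, 1, …`,
because the cyclic order has period `n`, and the first `m` of them have the same lengths. Hence `w`
from position `S p` on agrees with `w` for `S m` letters, and for one letter more, since the
letter of the next run is known before its length is (`agree_runStart`). As `S m ≥ m`, each
application of `S` lengthens the agreement, and the prefix of `w` of length `L` occurs at all
positions `S^[L] (n * i)` (`prefix_occurs_iterate`). These positions are
strictly increasing in `i`, and their gaps are at most `M ^ L * n`, where `M` bounds the letters.
So every prefix of `w`, and with it every factor, recurs with bounded gaps.
-/

/-- The position at which the `j`-th run of a word with run-length sequence `w` starts. -/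
def runStart (w : ℕ → ℕ) (j : ℕ) : ℕ := ∑ l ∈ Finset.range j, w l

lemma runStart_succ (w : ℕ → ℕ) (j : ℕ) : runStart w (j + 1) = runStart w j + w j :=
  Finset.sum_range_succ w j

lemma runStart_strictMono {w : ℕ → ℕ} (hw : ∀ j, 0 < w j) : StrictMono (runStart w) :=
  strictMono_nat_of_lt_succ fun j => by
    rw [runStart_succ]
    exact Nat.lt_add_of_pos_right (hw j)

lemma runStart_add_le {w : ℕ → ℕ} {M : ℕ} (hM : ∀ i, w i ≤ M) (p d : ℕ) :
    runStart w (p + d) ≤ runStart w p + M * d := by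
  induction d with
  | zero => simp
  | succ d ih =>
    rw [← add_assoc, runStart_succ, Nat.mul_succ]
    linarith [hM (p + d)]

/-- If `w (p + l) = w l` for `l < m`, the first `m` runs from the `p`-th on start at the same
positions, relative to the start of the `p`-th run, as the first `m` runs of the word. -/
lemma runStart_add_of_agree {w : ℕ → ℕ} {p m : ℕ} (h : ∀ l < m, w (p + l) = w l) :
    runStart w (p + m) = runStart w p + runStart w m := by
  rw [runStart, Finset.sum_range_add]
  congr 1
  exact Finset.sum_congr rfl fun l hl => h l (Finset.mem_range.mp hl)

/-- Every position lies in some run. -/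
lemma exists_eq_runStart_add {w : ℕ → ℕ} (hw : ∀ j, 0 < w j) (k : ℕ) :
    ∃ j i, i < w j ∧ k = runStart w j + i := by
  induction k with
  | zero => exact ⟨0, 0, hw 0, by simp [runStart]⟩
  | succ k ih =>
    obtain ⟨j, i, hi, rfl⟩ := ih
    rcases Nat.lt_or_ge (i + 1) (w j) with h | h
    · exact ⟨j, i + 1, h, rfl⟩
    · refine ⟨j + 1, 0, hw _, ?_⟩
      rw [runStart_succ]
      omega

lemma dvd_runStart {n r : ℕ} {w : ℕ → ℕ} (hr : ∀ i, w i ≡ r [MOD n]) {p : ℕ} (hp : n ∣ p) :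
    n ∣ runStart w p := by
  have h : ∀ j, runStart w j ≡ j * r [MOD n] := fun j => by
    induction j with
    | zero => simpa [runStart] using Nat.ModEq.refl 0
    | succ j ih =>
      rw [runStart_succ, Nat.succ_mul]
      exact ih.add (hr j)
  exact ((h p).dvd_iff dvd_rfl).mpr (hp.mul_right r)

/-- An agreement of `w` with its shift by `p`, for `m` letters, passes to the shift by `runStart w p`
and becomes an agreement for `runStart w m + 1` letters. -/
lemma agree_runStart {n : ℕ} {b : ZMod n → ℕ} {s : ZMod n} {w : ℕ → ℕ} (hw : ∀ j, 0 < w j)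
    (hrun : ∀ j k, k < w j → w (runStart w j + k) = b (s + j)) {p m : ℕ} (hp : n ∣ p)
    (h : ∀ l < m, w (p + l) = w l) {k : ℕ} (hk : k ≤ runStart w m) :
    w (runStart w p + k) = w k := by
  obtain ⟨j, i, hi, rfl⟩ := exists_eq_runStart_add hw k
  have hjm : j ≤ m := (runStart_strictMono hw).le_iff_le.mp (by omega)
  have hi' : i < w (p + j) := by
    rcases hjm.lt_or_eq with hj | rfl
    · rwa [h j hj]
    · -- Only the first letter of the run is claimed here, as its length in the shift is unknown.
      have := hw (p + j)
      omega
  rw [← add_assoc, ← runStart_add_of_agree fun l hl => h l (hl.trans_le hjm), hrun _ _ hi',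
    hrun _ _ hi, Nat.cast_add, (ZMod.natCast_eq_zero_iff p n).mpr hp, zero_add]

lemma prefix_occurs_iterate {n r : ℕ} {b : ZMod n → ℕ} {s : ZMod n} {w : ℕ → ℕ}
    (hw : ∀ j, 0 < w j) (hr : ∀ i, w i ≡ r [MOD n])
    (hrun : ∀ j k, k < w j → w (runStart w j + k) = b (s + j)) {p : ℕ} (hp : n ∣ p) (L : ℕ) :
    n ∣ (runStart w)^[L] p ∧ ∀ l < L, w ((runStart w)^[L] p + l) = w l := by
  induction L with
  | zero => exact ⟨hp, by simp⟩
  | succ L ih =>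
    rw [Function.iterate_succ_apply']
    refine ⟨dvd_runStart hr ih.1, fun l hl => agree_runStart hw hrun ih.1 ih.2 ?_⟩
    exact (Nat.lt_succ_iff.mp hl).trans (runStart_strictMono hw).le_apply

lemma iterate_runStart_add_le {w : ℕ → ℕ} (hw : ∀ j, 0 < w j) {M : ℕ} (hM : ∀ i, w i ≤ M)
    (L p d : ℕ) : (runStart w)^[L] (p + d) ≤ (runStart w)^[L] p + M ^ L * d := by
  induction L with
  | zero => simp
  | succ L ih =>
    rw [Function.iterate_succ_apply', Function.iterate_succ_apply', pow_succ', mul_assoc]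
    exact ((runStart_strictMono hw).monotone ih).trans (runStart_add_le hM _ _)

/-- A strictly increasing sequence with gaps at most `G` meets every window
`[N, N + f 0 + G]`. -/
lemma StrictMono.exists_mem_window {f : ℕ → ℕ} (hf : StrictMono f) {G : ℕ}
    (hG : ∀ i, f (i + 1) ≤ f i + G) (N : ℕ) : ∃ i, N ≤ f i ∧ f i ≤ N + (f 0 + G) := by
  induction N with
  | zero => exact ⟨0, Nat.zero_le _, by omega⟩
  | succ N ih =>
    obtain ⟨i, h₁, h₂⟩ := ih
    rcases h₁.lt_or_eq with h | h
    · exact ⟨i, h, by omega⟩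
    · have h₃ : f i < f (i + 1) := hf (Nat.lt_succ_self i)
      have h₄ := hG i
      exact ⟨i + 1, by omega, by omega⟩

lemma OccursAt.of_agree {v : List ℕ} {w : ℕ → ℕ} {p t : ℕ} (hv : OccursAt v w p)
    (h : ∀ l < p + v.length, w (t + l) = w l) : OccursAt v w (t + p) := by
  unfold OccursAt at hv ⊢
  refine Eq.trans (List.map_congr_left fun j hj => ?_) hv
  rw [add_assoc]
  exact h _ (Nat.add_lt_add_left (List.mem_range.mp hj) p)

/-- It suffices that every prefix occurs along a strictly increasing sequence of positions with
bounded gaps. -/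
lemma uniformlyRecurrent_of_prefix {w : ℕ → ℕ}
    (h : ∀ L, ∃ (f : ℕ → ℕ) (G : ℕ), StrictMono f ∧ (∀ i, f (i + 1) ≤ f i + G) ∧
      ∀ i, ∀ l < L, w (f i + l) = w l) : UniformlyRecurrent w := by
  rintro v ⟨p, hv⟩
  obtain ⟨f, G, hf, hG, hw⟩ := h (p + v.length)
  refine ⟨f 0 + G + p, fun N => ?_⟩
  obtain ⟨i, h₁, h₂⟩ := hf.exists_mem_window hG N
  exact ⟨f i + p, by omega, by omega, hv.of_agree (hw i)⟩

theorem theorem20 (n : ℕ) (hn : 1 < n) (a : Fin n → ℕ) (ha : StrictMono a)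
    (hpos : ∀ i, 0 < a i) (q : Fin n → ℕ) (r : ℕ) (hr : r < n)
    (hq : ∀ i, a i = q i * n + r) (hcase : r = 0 ∨ (0 < r ∧ Even n))
    (b : ZMod n → ℕ) (hb : IsCyclicOrder a b)
    (w : ℕ → ℕ) (hw : IsGeneralizedKolakoski a b w) :
    UniformlyRecurrent w := by
  obtain ⟨hmem, u, ⟨hwpos, -, hrun⟩, s, hs⟩ := hw
  have hmod : ∀ i, w i ≡ r [MOD n] := fun i => by
    obtain ⟨x, hx⟩ := hmem i
    rw [← hx, hq x]
    simp [Nat.ModEq]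
  have hM : ∀ i, w i ≤ Finset.univ.sup a := fun i => by
    obtain ⟨x, hx⟩ := hmem i
    exact hx ▸ Finset.le_sup (Finset.mem_univ x)
  have hletter : ∀ j k, k < w j → w (runStart w j + k) = b (s + j) := fun j k hk =>
    (hrun j k hk).trans (hs j)
  refine uniformlyRecurrent_of_prefix fun L =>
    ⟨fun i => (runStart w)^[L] (n * i), Finset.univ.sup a ^ L * n, ?_, fun i => ?_, fun i =>
      (prefix_occurs_iterate hwpos hmod hletter (Dvd.intro i rfl) L).2⟩
  · exact ((runStart_strictMono hwpos).iterate L).comp fun i j hij =>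
      Nat.mul_lt_mul_of_pos_left hij (by omega)
  · exact iterate_runStart_add_le hwpos hM L (n * i) n
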